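/- Let $D$ and $E$ be complex Hilbert spaces, let $m$ be normalized Lebesgue measure on the unit circle $\mathbb T$, and let $\mathcal B(D,E)$ be the space of bounded linear operators from $D$ to $E$. $H^\infty(\mathbb T,\mathcal B(D,E))$ denotes the set of (essentially) bounded SOT-measurable functions $\Phi:\mathbb T\to\mathcal B(D,E)$ such that $\int_{\mathbb T}\overline z^{\,n}\Phi(z)x\,dm(z)=0$ for all $n<0$ and all $x\in D$, and $H^2(\mathbb T,E)$ denotes the subspace of those $f\in L^2(\mathbb T,E)$ whose Fourier coefficients of negative index vanish. For a $\mathcal B(E,D)$-valued function $\Psi$ on $\mathbb T$, the Hankel operator $H_\Psi$ is $H_\Psi f=JP_-(\Psi f)$ for $f\in H^2(\mathbb T,E)$ (with $\Psi f\in L^2(\mathbb T,D)$), where $P_-$ is the orthogonal projection of $L^2(\mathbb T,D)$ onto $L^2(\mathbb T,D)\ominus H^2(\mathbb T,D)$ and $(Jg)(z)=\overline z\,g(\overline z)$. For $|\alpha|<1$ let $b_\alpha(z)=\frac{z-\alpha}{1-\overline\alpha z}$. A finite Blaschke product is a function $\theta=\nu\prod_{i=1}^n b_{\alpha_i}$ with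 $|\nu|=1$ and $|\alpha_i|<1$. A function $\Phi\in H^\infty(\mathbb T,\mathcal B(D,E))$ is called rational if $\theta H^2(\mathbb T,E)\subseteq\ker H_{\Phi^*}$ for some finite Blaschke product $\theta$. A finite Blaschke–Potapov product on $E$ is a function of the form $V\prod_{i=1}^{n}\bigl(b_{\alpha_i}P_i+(I-P_i)\bigr)$ with $V$ a unitary operator on $E$, $|\alpha_i|<1$ and $P_i$ orthogonal projections in $E$ ($n\ge 0$). A function $\Omega\in H^\infty(\mathbb T,\mathcal B(D',E))$, with $D'$ a complex Hilbert space, is inner if $\Omega^*\Omega=I_{D'}$ a.e. on $\mathbb T$, and it is a left inner divisor of $\Phi$ if it is inner and $\Phi=\Omega B$ a.e. for some $B\in H^\infty(\mathbb T,\mathcal B(D,D'))$. Two functions with values in $\mathcal B(D_1,E)$ and $\mathcal B(D_2,E)$ are left coprime if every common left inner divisor of them is a constant unitary operator (that is, there is a unitary $U:D'\to E$ such that, for each $x\in D'$, $\Omega(z)x=Ux$ for almost all $z$). Two functions $\Phi$ and $\Psi$ with a common domain space are right coprime if $\widetilde\Phi$ and $\widetilde\Psi$ are left coprime, where $\widetilde\Phi(z)=\Phi(\overline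 z)^*$. Then a function $\Phi\in H^\infty(\mathbb T,\mathcal B(D,E))$ is rational if and only if there are a finite Blaschke–Potapov product $\Delta$ on $E$ and a function $A\in H^\infty(\mathbb T,\mathcal B(E,D))$ such that $\Delta$ and $A$ are right coprime and $$\Phi=\Delta A^*\quad\text{a.e. on }\mathbb T.$$ -/

import Mathlib

open MeasureTheory ContinuousLinearMap
open scoped ComplexConjugate InnerProductSpace

namespace OperatorHardy

universe u v w

/-- The normalized Lebesgue measure `m` on the unit circle. The unit circle is Mathlib's `ℝ / ℤ`,
a point `t` standing for the complex number `exp (2 π i t)`, see `coord`; complex conjugation of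
the circle is `t ↦ -t`. With this convention `fourierCoeff f n` is `∫ z⁻ⁿ f(z) dm(z)`. -/
noncomputable abbrev m : Measure UnitAddCircle := AddCircle.haarAddCircle

/-- The coordinate function `z` on the unit circle. -/
noncomputable def coord (t : UnitAddCircle) : ℂ := (AddCircle.toCircle t : ℂ)

section SpacesOfFunctions

variable {D : Type v} [NormedAddCommGroup D] [InnerProductSpace ℂ D]
variable {E : Type u} [NormedAddCommGroup E] [InnerProductSpace ℂ E]

/-- `H²(𝕋, E)`, the functions of `L²(𝕋, E)` whose Fourier coefficients of negative index vanish. -/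
noncomputable def hardyTwo (E : Type u) [NormedAddCommGroup E] [InnerProductSpace ℂ E] :
    Submodule ℂ (Lp E 2 m) where
  carrier := {f | ∀ n : ℤ, n < 0 → fourierCoeff (f : UnitAddCircle → E) n = 0}
  zero_mem' := by
    intro n _
    rw [fourierCoeff_congr_ae (Lp.coeFn_zero E 2 m)]
    simp [fourierCoeff]
  add_mem' := by
    intro f g hf hg n hn
    have hfi : Integrable (f : UnitAddCircle → E) m := (Lp.memLp f).integrable (by norm_num)
    have hgi : Integrable (g : UnitAddCircle → E) m := (Lp.memLp g).integrable (by norm_num)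
    rw [fourierCoeff_congr_ae (Lp.coeFn_add f g), fourierCoeff.add hfi hgi]
    simp [hf n hn, hg n hn]
  smul_mem' := by
    intro c f hf n hn
    rw [fourierCoeff_congr_ae (Lp.coeFn_smul c f)]
    have h := fourierCoeff.const_smul (f : UnitAddCircle → E) c n
    rw [hf n hn, smul_zero] at h
    exact h

/-- Membership in `L^∞(𝕋, B(D, E))`: bounded (almost everywhere) and SOT-measurable. -/
def MemLInfty (Φ : UnitAddCircle → D →L[ℂ] E) : Prop :=
  (∀ x : D, AEStronglyMeasurable (fun t => Φ t x) m) ∧ ∃ C : ℝ, ∀ᵐ t ∂m, ‖Φ t‖ ≤ C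

/-- Membership in `H^∞(𝕋, B(D, E))`: the Fourier coefficients `x ↦ (Φ(·)x)^(n)` of
negative index vanish. -/
def MemHInfty (Φ : UnitAddCircle → D →L[ℂ] E) : Prop :=
  MemLInfty Φ ∧ ∀ n : ℤ, n < 0 → ∀ x : D, fourierCoeff (fun t => Φ t x) n = 0

/-- A function almost everywhere on the circle being a constant unitary operator from `D` onto `E`,
equality being, as for all strong `L^p` functions, tested on each vector (for separable `D`
this is equality of operators almost everywhere). -/
def IsUnitaryConstant (Φ : UnitAddCircle → D →L[ℂ] E) : Prop :=
  ∃ U : D ≃ₗᵢ[ℂ] E, ∀ x : D, ∀ᵐ t ∂m, Φ t x = U x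

end SpacesOfFunctions

section Divisors

variable {D : Type v} [NormedAddCommGroup D] [InnerProductSpace ℂ D] [CompleteSpace D]
variable {E : Type u} [NormedAddCommGroup E] [InnerProductSpace ℂ E] [CompleteSpace E]

/-- Inner functions: `Δ ∈ H^∞(𝕋, B(D, E))` with `Δ* Δ = I` almost everywhere. -/
def IsInner (Δ : UnitAddCircle → D →L[ℂ] E) : Prop :=
  MemHInfty Δ ∧ ∀ᵐ t ∂m, adjoint (Δ t) ∘L Δ t = ContinuousLinearMap.id ℂ D

/-- `Δ ∈ H^∞(𝕋, B(D', E))` is a left inner divisor of `Φ ∈ H^∞(𝕋, B(D, E))`: `Δ` is inner and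
`Φ = Δ B` for some `B ∈ H^∞(𝕋, B(D, D'))`. -/
def IsLeftInnerDivisor {D' : Type w} [NormedAddCommGroup D'] [InnerProductSpace ℂ D']
    [CompleteSpace D'] (Δ : UnitAddCircle → D' →L[ℂ] E) (Φ : UnitAddCircle → D →L[ℂ] E) : Prop :=
  IsInner Δ ∧ ∃ B : UnitAddCircle → D →L[ℂ] D', MemHInfty B ∧ ∀ᵐ t ∂m, Φ t = Δ t ∘L B t

/-- `Φ` and `Ψ` are left coprime: every common left inner divisor is trivial, i.e. a unitary
constant. The Hilbert space `D'` may be any one in the universe of `E`; this is no restriction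
since the values of an inner function embed `D'` isometrically in `E`. -/
def LeftCoprime {D₁ : Type v} [NormedAddCommGroup D₁] [InnerProductSpace ℂ D₁] [CompleteSpace D₁]
    {D₂ : Type w} [NormedAddCommGroup D₂] [InnerProductSpace ℂ D₂] [CompleteSpace D₂]
    (Φ : UnitAddCircle → D₁ →L[ℂ] E) (Ψ : UnitAddCircle → D₂ →L[ℂ] E) : Prop :=
  ∀ (D' : Type u) [NormedAddCommGroup D'] [InnerProductSpace ℂ D'] [CompleteSpace D']
    (Ω : UnitAddCircle → D' →L[ℂ] E),
    IsLeftInnerDivisor Ω Φ → IsLeftInnerDivisor Ω Ψ → IsUnitaryConstant Ω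

/-- The function `z ↦ Φ(conj z)*`. -/
noncomputable def tilde (Φ : UnitAddCircle → D →L[ℂ] E) (t : UnitAddCircle) : E →L[ℂ] D :=
  adjoint (Φ (-t))

/-- `Φ` and `Ψ` are right coprime: `tilde Φ` and `tilde Ψ` are left coprime. -/
def RightCoprime {E₁ : Type v} [NormedAddCommGroup E₁] [InnerProductSpace ℂ E₁] [CompleteSpace E₁]
    {E₂ : Type w} [NormedAddCommGroup E₂] [InnerProductSpace ℂ E₂] [CompleteSpace E₂]
    (Φ : UnitAddCircle → E →L[ℂ] E₁) (Ψ : UnitAddCircle → E →L[ℂ] E₂) : Prop :=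
  LeftCoprime (tilde Φ) (tilde Ψ)

end Divisors

section BlaschkeProducts

/-- The Blaschke factor `b_α(z) = (z - α) / (1 - conj α z)`. -/
noncomputable def blaschkeFactor (α z : ℂ) : ℂ := (z - α) / (1 - conj α * z)

/-- Finite (scalar) Blaschke products on the circle: `θ = ν ∏ b_{α_i}`, where `|ν| = 1` and
all `α_i` lie in the open unit disc. -/
def IsFiniteBlaschkeProduct (θ : UnitAddCircle → ℂ) : Prop :=
  ∃ (ν : ℂ) (n : ℕ) (α : Fin n → ℂ), ‖ν‖ = 1 ∧ (∀ i, ‖α i‖ < 1) ∧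
    ∀ t, θ t = ν * ∏ i, blaschkeFactor (α i) (coord t)

variable {E : Type u} [NormedAddCommGroup E] [InnerProductSpace ℂ E] [CompleteSpace E]

/-- Finite Blaschke-Potapov products: `Δ = V ∏ (b_i P_i + (I - P_i))` almost everywhere, where
`V` is a unitary operator on `E`, the `b_i` are Blaschke factors and the `P_i` are orthogonal
projections in `E`; the product is taken in the order of the indices. -/
def IsFiniteBlaschkePotapovProduct (Δ : UnitAddCircle → E →L[ℂ] E) : Prop :=
  ∃ (V : E →L[ℂ] E) (n : ℕ) (α : Fin n → ℂ) (P : Fin n → E →L[ℂ] E),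
    V ∈ unitary (E →L[ℂ] E) ∧ (∀ i, ‖α i‖ < 1) ∧ (∀ i, IsStarProjection (P i)) ∧
    ∀ᵐ t ∂m, Δ t =
      V * (List.ofFn fun i => blaschkeFactor (α i) (coord t) • P i + (1 - P i)).prod

end BlaschkeProducts

section Hankel

theorem memLp_reflect {E : Type u} [NormedAddCommGroup E] [InnerProductSpace ℂ E]
    (g : Lp E 2 m) :
    MemLp (fun t : UnitAddCircle => conj (coord t) • (g : UnitAddCircle → E) (-t)) 2 m := by
  have h1 : MemLp (fun t : UnitAddCircle => (g : UnitAddCircle → E) (-t)) 2 m :=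
    (Lp.memLp g).comp_measurePreserving (Measure.measurePreserving_neg m)
  have hc : Continuous fun t : UnitAddCircle => conj (coord t) :=
    Complex.continuous_conj.comp (continuous_subtype_val.comp AddCircle.continuous_toCircle)
  refine h1.of_le (hc.aestronglyMeasurable.smul h1.1) (Filter.Eventually.of_forall fun t => ?_)
  rw [norm_smul, RCLike.norm_conj, coord, Circle.norm_coe, one_mul]

/-- The operator `J` on `L²(𝕋, E)`, `(J g)(z) = conj z • g(conj z)`. -/
noncomputable def reflect {E : Type u} [NormedAddCommGroup E] [InnerProductSpace ℂ E]
    (g : Lp E 2 m) : Lp E 2 m := (memLp_reflect g).toLp _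

variable {D : Type v} [NormedAddCommGroup D] [InnerProductSpace ℂ D] [CompleteSpace D]
variable {E : Type u} [NormedAddCommGroup E] [InnerProductSpace ℂ E] [CompleteSpace E]

/-- The value `H_Ψ f = J P₋ (Ψ f)` of the Hankel operator with symbol `Ψ` at a function `f` for
which `Ψ f` is in `L²`; here `P₋` is the orthogonal projection of `L²` onto the orthogonal
complement of `H²`. -/
noncomputable def hankel (Ψ : UnitAddCircle → E →L[ℂ] D) (f : Lp E 2 m)
    (h : MemLp (fun t => Ψ t (f t)) 2 m) : Lp D 2 m :=
  reflect ((hardyTwo D)ᗮ.starProjection (h.toLp _))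

/-- The kernel of the Hankel operator `H_Ψ : H²(𝕋, E) → H²(𝕋, D)`. (For `Ψ` in
`L^∞(𝕋, B(E, D))` the function `Ψ f` is in `L²` for all `f` in `L²`. When `Ψ = Φ*` with `Φ` in
`L^∞(𝕋, B(D, E))` this covers all cases with separable spaces; in general, `f` has to be in the
natural domain of `H_Ψ`.) -/
def hankelKer (Ψ : UnitAddCircle → E →L[ℂ] D) : Set (Lp E 2 m) :=
  {f | f ∈ hardyTwo E ∧ ∃ h : MemLp (fun t => Ψ t (f t)) 2 m, hankel Ψ f h = 0}

/-- Rational functions in `H^∞(𝕋, B(D, E))`: `θ H²(𝕋, E) ⊆ ker H_{Φ*}` for some finite Blaschke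
product `θ`. -/
def IsRational (Φ : UnitAddCircle → D →L[ℂ] E) : Prop :=
  ∃ θ : UnitAddCircle → ℂ, IsFiniteBlaschkeProduct θ ∧
    {g : Lp E 2 m | ∃ f ∈ hardyTwo E, ∀ᵐ t ∂m, g t = θ t • f t} ⊆
      hankelKer (fun t => adjoint (Φ t))

end Hankel

end OperatorHardy

/-! Tested on constant functions, rationality loses its Hankel operators: Φ is rational exactly when
A₀ = θΦ* lies in H^∞ for some scalar finite Blaschke product θ (`isRational_iff`), and then Φ =
θA₀*. It remains to cancel what θI and A₀ have in common.

After passing to `tilde` this becomes left division, carried out one zero α at a time in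
`exists_coprime_factorization`. Put b = b_α, let T = Ψ(α) and let Q be the projection onto the
closure of the range of T. Then (1 - Q)Ψ vanishes at α, so b(1 - Q) + Q divides Ψ on the left. Since
bI = (b(1 - Q) + Q)(bQ + (1 - Q)), the factor bQ + (1 - Q) is left over. The quotient of Ψ is
treated at the remaining zeros, and the leftover factors multiply to a Potapov product. Coprimality
survives each step because T has dense range in the range of Q.

Conversely, if θ collects the zeros of a Potapov product Δ, then θΔ* is analytic, and so is θΦ* =
AθΔ*.

The spaces need not be separable, so SOT-measurability does not pass to adjoints for free and is
tracked separately. -/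

namespace OperatorHardy

/-! ### Fourier coefficients of vector-valued functions. -/

section Coefficients

variable {D : Type*} [NormedAddCommGroup D] [InnerProductSpace ℂ D]
variable {E : Type*} [NormedAddCommGroup E] [InnerProductSpace ℂ E]

theorem coord_eq_fourier (t : UnitAddCircle) : coord t = fourier 1 t := by
  rw [fourier_one]; rfl

theorem continuous_coord : Continuous coord :=
  continuous_subtype_val.comp AddCircle.continuous_toCircle

@[simp] theorem norm_coord (t : UnitAddCircle) : ‖coord t‖ = 1 := Circle.norm_coe _

theorem coord_neg (t : UnitAddCircle) : coord (-t) = conj (coord t) := by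
  rw [coord, AddCircle.toCircle_neg, Circle.coe_inv_eq_conj, coord]

theorem conj_coord_mul (t : UnitAddCircle) : conj (coord t) * coord t = 1 := by
  rw [← Complex.normSq_eq_conj_mul_self, Complex.normSq_eq_norm_sq]; simp

theorem fourierCoeff_coord_smul (f : UnitAddCircle → E) (n : ℤ) :
    fourierCoeff (fun t => coord t • f t) n = fourierCoeff f (n - 1) := by
  unfold fourierCoeff
  congr 1 with t
  rw [smul_smul, coord_eq_fourier, ← fourier_add]
  congr 3
  ring

theorem fourierCoeff_smul_const [CompleteSpace E] (b : UnitAddCircle → ℂ) (x : E) (n : ℤ) :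
    fourierCoeff (fun t => b t • x) n = fourierCoeff b n • x := by
  unfold fourierCoeff
  rw [← integral_smul_const]
  congr 1 with t
  rw [smul_smul, smul_eq_mul]

theorem fourierCoeff_inner [CompleteSpace E] {f : UnitAddCircle → E} (hf : Integrable f m) (y : E)
    (n : ℤ) : fourierCoeff (fun t => ⟪y, f t⟫_ℂ) n = ⟪y, fourierCoeff f n⟫_ℂ := by
  unfold fourierCoeff
  rw [← integral_inner (hf.fourier_smul _)]
  congr 1 with t
  rw [inner_smul_right, smul_eq_mul]

theorem fourierCoeff_conj (f : UnitAddCircle → ℂ) (n : ℤ) :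
    fourierCoeff (fun t => conj (f t)) n = conj (fourierCoeff f (-n)) := by
  unfold fourierCoeff
  rw [← integral_conj]
  congr 1 with t
  rw [smul_eq_mul, smul_eq_mul, map_mul, ← fourier_neg, neg_neg]

theorem fourierCoeff_comp_neg (f : UnitAddCircle → E) (n : ℤ) :
    fourierCoeff (fun t => f (-t)) n = fourierCoeff f (-n) := by
  unfold fourierCoeff
  rw [← integral_neg_eq_self]
  congr 1 with t
  simp only [neg_neg, fourier_apply, smul_neg, neg_smul]

theorem norm_fourierCoeff_le {f : UnitAddCircle → E} {C : ℝ} (h : ∀ᵐ t ∂m, ‖f t‖ ≤ C) (n : ℤ) :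
    ‖fourierCoeff f n‖ ≤ C := by
  have : ∀ᵐ t ∂m, ‖fourier (-n) t • f t‖ ≤ C := by
    filter_upwards [h] with t ht
    rwa [norm_smul, fourier_apply, Circle.norm_coe, one_mul]
  unfold fourierCoeff
  refine (norm_integral_le_of_norm_le_const this).trans ?_
  simp

theorem fourierCoeff_sub {f g : UnitAddCircle → E} (hf : Integrable f m) (hg : Integrable g m)
    (n : ℤ) : fourierCoeff (fun t => f t - g t) n = fourierCoeff f n - fourierCoeff g n := by
  unfold fourierCoeff
  rw [← integral_sub (hf.fourier_smul _) (hg.fourier_smul _)]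
  congr 1 with t
  rw [smul_sub]

theorem fourierCoeff_add {f g : UnitAddCircle → E} (hf : Integrable f m) (hg : Integrable g m)
    (n : ℤ) : fourierCoeff (fun t => f t + g t) n = fourierCoeff f n + fourierCoeff g n :=
  congrFun (fourierCoeff.add hf hg) n

theorem ae_eq_zero_of_fourierCoeff_complex {f : UnitAddCircle → ℂ} (hf : MemLp f 2 m)
    (h : ∀ n, fourierCoeff f n = 0) : f =ᵐ[m] 0 := by
  have h0 : (fourierBasis (T := 1)).repr (hf.toLp f) = 0 := by
    ext n
    rw [fourierBasis_repr, fourierCoeff_congr_ae hf.coeFn_toLp, h n]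
    rfl
  rw [LinearIsometryEquiv.map_eq_zero_iff] at h0
  filter_upwards [hf.coeFn_toLp, Lp.eq_zero_iff_ae_eq_zero.1 h0] with t h1 h2
  rw [← h1, h2]

/-- Strong measurability makes the range essentially separable, so pairing with fixed vectors
reduces the claim to the scalar Fourier basis. -/
theorem ae_eq_zero_of_fourierCoeff [CompleteSpace E] {f : UnitAddCircle → E} (hf : MemLp f 2 m)
    (h : ∀ n, fourierCoeff f n = 0) : f =ᵐ[m] 0 := by
  obtain ⟨s, hs, hfs⟩ := hf.1.isSeparable_ae_range
  refine ae_eq_zero_of_forall_dual_of_isSeparable ℂ hs (fun c => ?_) hfs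
  obtain ⟨y, rfl⟩ := (InnerProductSpace.toDual ℂ E).surjective c
  refine ae_eq_zero_of_fourierCoeff_complex (f := fun t => ⟪y, f t⟫_ℂ) (hf.const_inner y)
    fun n => ?_
  rw [fourierCoeff_inner (hf.integrable (by norm_num)), h n, inner_zero_right]

/-- A function all of whose Fourier coefficients except the one of index zero vanish is constant. -/
theorem ae_eq_const_of_fourierCoeff [CompleteSpace E] {f : UnitAddCircle → E} (hf : MemLp f 2 m)
    (h : ∀ n, n ≠ 0 → fourierCoeff f n = 0) : ∀ᵐ t ∂m, f t = fourierCoeff f 0 := by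
  have hfi : Integrable f m := hf.integrable (by norm_num)
  have := ae_eq_zero_of_fourierCoeff (f := fun t => f t - fourierCoeff f 0)
    (hf.sub (memLp_const _)) fun n => ?_
  · filter_upwards [this] with t ht using sub_eq_zero.1 ht
  · rw [fourierCoeff_sub hfi (integrable_const _)]
    have h1 : fourierCoeff (fun _ : UnitAddCircle => fourierCoeff f 0) n
        = fourierCoeff (fourier 0 : UnitAddCircle → ℂ) n • fourierCoeff f 0 := by
      rw [← fourierCoeff_smul_const]
      simp
    rw [h1, fourierCoeff_fourier]
    rcases eq_or_ne n 0 with rfl | hn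
    · simp
    · simp [h n hn, hn]

theorem integrable_coord_smul {f : UnitAddCircle → E} (hf : Integrable f m) :
    Integrable (fun t => coord t • f t) m := by
  simpa only [coord_eq_fourier] using hf.fourier_smul 1

theorem fourierCoeff_one_sub_mul_coord_smul {f : UnitAddCircle → E} (hf : Integrable f m) (c : ℂ)
    (n : ℤ) : fourierCoeff (fun t => (1 - c * coord t) • f t) n =
      fourierCoeff f n - c • fourierCoeff f (n - 1) := by
  rw [← fourierCoeff_coord_smul, ← fourierCoeff.const_smul,
    ← fourierCoeff_sub (g := c • fun t => coord t • f t) hf ((integrable_coord_smul hf).smul c)]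
  congr 1 with t
  simp [sub_smul, mul_smul]

theorem fourierCoeff_coord_sub_smul {f : UnitAddCircle → E} (hf : Integrable f m) (c : ℂ)
    (n : ℤ) : fourierCoeff (fun t => (coord t - c) • f t) n =
      fourierCoeff f (n - 1) - c • fourierCoeff f n := by
  rw [← fourierCoeff_coord_smul, ← fourierCoeff.const_smul,
    ← fourierCoeff_sub (g := c • f) (integrable_coord_smul hf) (hf.smul c)]
  congr 1 with t
  simp [sub_smul]

end Coefficients

/-! ### H² and H^∞, and multiplication of one by the other. -/

section Hardy

variable {C : Type*} [NormedAddCommGroup C] [InnerProductSpace ℂ C]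
variable {D : Type*} [NormedAddCommGroup D] [InnerProductSpace ℂ D]
variable {E : Type*} [NormedAddCommGroup E] [InnerProductSpace ℂ E]

/-- The functions whose class in `L²` belongs to `H²`. -/
def MemHTwo (f : UnitAddCircle → E) : Prop :=
  MemLp f 2 m ∧ ∀ n : ℤ, n < 0 → fourierCoeff f n = 0

theorem MemHTwo.integrable {f : UnitAddCircle → E} (hf : MemHTwo f) : Integrable f m :=
  hf.1.integrable (by norm_num)

theorem MemHTwo.congr {f g : UnitAddCircle → E} (hf : MemHTwo f) (h : f =ᵐ[m] g) : MemHTwo g :=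
  ⟨hf.1.ae_eq h, fun n hn => by rw [← fourierCoeff_congr_ae h, hf.2 n hn]⟩

theorem MemHTwo.toLp_mem {f : UnitAddCircle → E} (hf : MemHTwo f) :
    hf.1.toLp f ∈ hardyTwo E := fun n hn => by
  rw [fourierCoeff_congr_ae hf.1.coeFn_toLp, hf.2 n hn]

theorem memHTwo_of_mem {f : Lp E 2 m} (hf : f ∈ hardyTwo E) : MemHTwo f := ⟨Lp.memLp f, hf⟩

/-- Measurability of A is known only on fixed vectors, hence on simple functions; for general g it
follows by pointwise limits, each A(t) being continuous. -/
theorem aestronglyMeasurable_clm_apply {A : UnitAddCircle → D →L[ℂ] E}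
    (hA : ∀ x, AEStronglyMeasurable (fun t => A t x) m) {g : UnitAddCircle → D}
    (hg : AEStronglyMeasurable g m) : AEStronglyMeasurable (fun t => A t (g t)) m := by
  have key : ∀ s : SimpleFunc UnitAddCircle D, AEStronglyMeasurable (fun t => A t (s t)) m := by
    intro s
    induction s using SimpleFunc.induction with
    | const c hs =>
      refine ((hA c).indicator hs).congr (Filter.Eventually.of_forall fun t => ?_)
      by_cases ht : t ∈ ‹Set _› <;> simp [ht]
    | add hd hf hg => exact (hf.add hg).congr (Filter.Eventually.of_forall fun t => by simp)
  obtain ⟨g', hg', hgg⟩ := hg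
  refine aestronglyMeasurable_of_tendsto_ae Filter.atTop (fun n => key (hg'.approx n)) ?_
  filter_upwards [hgg] with t ht
  rw [ht]
  exact ((A t).continuous.tendsto _).comp (hg'.tendsto_approx t)

theorem MemLInfty.memLp {A : UnitAddCircle → D →L[ℂ] E} (hA : MemLInfty A) {g : UnitAddCircle → D}
    (hg : MemLp g 2 m) : MemLp (fun t => A t (g t)) 2 m := by
  obtain ⟨C, hC⟩ := hA.2
  refine hg.of_le_mul (c := C) (aestronglyMeasurable_clm_apply hA.1 hg.1) ?_
  filter_upwards [hC] with t ht
  exact (A t).le_of_opNorm_le ht _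

theorem MemLInfty.congr {A B : UnitAddCircle → D →L[ℂ] E} (hA : MemLInfty A) (h : A =ᵐ[m] B) :
    MemLInfty B := by
  refine ⟨fun x => (hA.1 x).congr (h.fun_comp (· x)), hA.2.imp fun C hC => ?_⟩
  filter_upwards [hC, h] with t h1 h2
  rwa [← h2]

theorem MemHInfty.congr {A B : UnitAddCircle → D →L[ℂ] E} (hA : MemHInfty A) (h : A =ᵐ[m] B) :
    MemHInfty B :=
  ⟨hA.1.congr h, fun n hn x => by
    rw [← hA.2 n hn x, fourierCoeff_congr_ae (f := fun t => B t x) (g := fun t => A t x)]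
    exact h.symm.fun_comp (· x)⟩

theorem MemHInfty.apply {A : UnitAddCircle → D →L[ℂ] E} (hA : MemHInfty A) (x : D) :
    MemHTwo (fun t => A t x) := ⟨hA.1.memLp (memLp_const x), fun n hn => hA.2 n hn x⟩

theorem MemLInfty.memHInfty {A : UnitAddCircle → D →L[ℂ] E} (hA : MemLInfty A)
    (h : ∀ x, MemHTwo (fun t => A t x)) : MemHInfty A := ⟨hA, fun n hn x => (h x).2 n hn⟩

theorem integral_norm_le_norm_Lp {F : Type*} [NormedAddCommGroup F] (g : Lp F 2 m) :
    ∫ t, ‖g t‖ ∂m ≤ ‖g‖ := by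
  have h1 : MemLp g 1 m := (Lp.memLp g).mono_exponent (by norm_num)
  rw [integral_norm_eq_lintegral_enorm h1.1, ← eLpNorm_one_eq_lintegral_enorm, Lp.norm_def]
  exact ENNReal.toReal_mono (Lp.eLpNorm_ne_top g)
    (eLpNorm_le_eLpNorm_of_exponent_le (by norm_num) h1.1)

/-- The `n`-th Fourier coefficient of `A g` as a continuous linear function of `g ∈ L²`. -/
noncomputable def coeffCLM (A : UnitAddCircle → D →L[ℂ] E) (hA : MemLInfty A) (n : ℤ) :
    Lp D 2 m →L[ℂ] E :=
  LinearMap.mkContinuousOfExistsBound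
    { toFun := fun g => fourierCoeff (fun t => A t (g t)) n
      map_add' := fun f g => by
        have hi : ∀ f : Lp D 2 m, Integrable (fun t => A t (f t)) m := fun f =>
          (hA.memLp (Lp.memLp f)).integrable (by norm_num)
        rw [← fourierCoeff_add (hi f) (hi g)]
        refine congrFun (fourierCoeff_congr_ae ?_) n
        filter_upwards [Lp.coeFn_add f g] with t ht
        rw [ht, Pi.add_apply, map_add]
      map_smul' := fun c f => by
        rw [RingHom.id_apply, ← fourierCoeff.const_smul]
        refine congrFun (fourierCoeff_congr_ae ?_) n
        filter_upwards [Lp.coeFn_smul c f] with t ht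
        rw [ht, Pi.smul_apply, map_smul]
        rfl }
    (by
      obtain ⟨C, hC⟩ := hA.2
      have hC0 : 0 ≤ C := by
        obtain ⟨t, ht⟩ := hC.exists
        exact (norm_nonneg _).trans ht
      refine ⟨C, fun g => ?_⟩
      calc ‖fourierCoeff (fun t => A t (g t)) n‖
          ≤ ∫ t, C * ‖g t‖ ∂m := by
            refine norm_integral_le_of_norm_le
              (((Lp.memLp g).integrable (by norm_num)).norm.const_mul C) ?_
            filter_upwards [hC] with t ht
            rw [norm_smul, fourier_apply, Circle.norm_coe, one_mul]
            exact (A t).le_of_opNorm_le ht _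
        _ ≤ C * ‖g‖ := by
            rw [integral_const_mul]
            exact mul_le_mul_of_nonneg_left (integral_norm_le_norm_Lp g) hC0)

theorem memLInfty_const (T : D →L[ℂ] E) : MemLInfty (fun _ => T) :=
  ⟨fun _ => aestronglyMeasurable_const, ‖T‖, by simp⟩

theorem isClosed_hardyTwo : IsClosed (hardyTwo E : Set (Lp E 2 m)) := by
  have : (hardyTwo E : Set (Lp E 2 m)) =
      ⋂ n : ℤ, ⋂ _ : n < 0, {f | coeffCLM _ (memLInfty_const (.id ℂ E)) n f = 0} := by
    ext f
    simp only [Set.mem_iInter]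
    rfl
  rw [this]
  exact isClosed_biInter fun n _ => isClosed_singleton.preimage (ContinuousLinearMap.continuous _)

theorem memLp_fourier_smul (n : ℤ) (x : E) :
    MemLp (fun t : UnitAddCircle => fourier n t • x) 2 m :=
  ((memLp_const x : MemLp (fun _ => x) 2 m).of_le
    ((fourier n).continuous.aestronglyMeasurable.smul aestronglyMeasurable_const)
    (.of_forall fun t => by rw [norm_smul, fourier_apply, Circle.norm_coe, one_mul]))

/-- The span in `L²` of the functions `zⁿ x` with `n ≥ 0`. -/
noncomputable def analyticPolynomials (E : Type*) [NormedAddCommGroup E] [InnerProductSpace ℂ E] :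
    Submodule ℂ (Lp E 2 m) :=
  Submodule.span ℂ {f | ∃ (n : ℤ) (x : E), 0 ≤ n ∧ f = (memLp_fourier_smul n x).toLp _}

/-- The difference between f and its projection onto the closure lies in H² and is orthogonal to all
zⁿx with n ≥ 0. Its coefficients therefore vanish on both sides of zero. -/
theorem hardyTwo_le_closure [CompleteSpace E] :
    hardyTwo E ≤ (analyticPolynomials E).topologicalClosure := by
  have hle : (analyticPolynomials E).topologicalClosure ≤ hardyTwo E := by
    refine Submodule.topologicalClosure_minimal _ (Submodule.span_le.2 ?_) isClosed_hardyTwo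
    rintro _ ⟨n, x, hn, rfl⟩ k hk
    rw [fourierCoeff_congr_ae (MemLp.coeFn_toLp _), fourierCoeff_smul_const, fourierCoeff_fourier]
    simp [show k ≠ n by omega]
  intro f hf
  set K := (analyticPolynomials E).topologicalClosure with hK
  have : CompleteSpace K := (Submodule.isClosed_topologicalClosure _).completeSpace_coe
  have h0 : f - K.starProjection f = 0 := by
    have h1 : f - K.starProjection f ∈ hardyTwo E :=
      sub_mem hf (hle (K.starProjection_apply_mem f))
    have h2 : f - K.starProjection f ∈ Kᗮ := K.sub_starProjection_mem_orthogonal f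
    set g := f - K.starProjection f
    refine Lp.eq_zero_iff_ae_eq_zero.2 (ae_eq_zero_of_fourierCoeff (Lp.memLp g) fun n => ?_)
    rcases lt_or_ge n 0 with hn | hn
    · exact h1 n hn
    · refine ext_inner_left ℂ fun y => ?_
      have h3 := (Submodule.mem_orthogonal _ _).1 h2 _
        ((Submodule.le_topologicalClosure _) (Submodule.subset_span ⟨n, y, hn, rfl⟩))
      rw [L2.inner_def] at h3
      rw [← fourierCoeff_inner ((Lp.memLp g).integrable (by norm_num)), inner_zero_right, ← h3]
      refine integral_congr_ae ?_
      filter_upwards [(memLp_fourier_smul n y).coeFn_toLp] with t ht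
      rw [ht, inner_smul_left, fourier_neg, smul_eq_mul]
  rw [sub_eq_zero.1 h0]
  exact K.starProjection_apply_mem f

/-- Each negative coefficient of Ag is continuous in g ∈ L² and vanishes on the functions zᵏx with k
≥ 0, whose span is dense in H². -/
theorem MemHInfty.memHTwo [CompleteSpace D] [CompleteSpace E] {A : UnitAddCircle → D →L[ℂ] E}
    (hA : MemHInfty A)
    {g : UnitAddCircle → D} (hg : MemHTwo g) : MemHTwo (fun t => A t (g t)) := by
  refine ⟨hA.1.memLp hg.1, fun n hn => ?_⟩
  have hle : (analyticPolynomials D).topologicalClosure ≤ (coeffCLM A hA.1 n).ker := by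
    refine Submodule.topologicalClosure_minimal _ (Submodule.span_le.2 ?_)
      (ContinuousLinearMap.isClosed_ker _)
    rintro _ ⟨k, x, hk, rfl⟩
    change fourierCoeff _ n = 0
    have : (fun t => A t ((memLp_fourier_smul k x).toLp _ t)) =ᵐ[m]
        fun t => fourier k t • A t x := by
      filter_upwards [(memLp_fourier_smul k x).coeFn_toLp] with t ht
      rw [ht, map_smul]
    rw [fourierCoeff_congr_ae this]
    refine Eq.trans ?_ (hA.2 (n - k) (by omega) x)
    unfold fourierCoeff
    congr 1 with t
    rw [smul_smul, ← fourier_add]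
    congr 3
    ring
  have := hle (hardyTwo_le_closure hg.toLp_mem)
  change fourierCoeff _ n = 0 at this
  rw [← this]
  refine congrFun (fourierCoeff_congr_ae ?_) n
  filter_upwards [hg.1.coeFn_toLp] with t ht
  rw [ht]

theorem MemLInfty.comp {A : UnitAddCircle → D →L[ℂ] E} {B : UnitAddCircle → C →L[ℂ] D}
    (hA : MemLInfty A) (hB : MemLInfty B) : MemLInfty (fun t => A t ∘L B t) := by
  refine ⟨fun x => aestronglyMeasurable_clm_apply hA.1 (hB.1 x), ?_⟩
  obtain ⟨a, ha⟩ := hA.2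
  obtain ⟨b, hb⟩ := hB.2
  refine ⟨a * b, ?_⟩
  filter_upwards [ha, hb] with t h1 h2
  exact (opNorm_comp_le _ _).trans (mul_le_mul h1 h2 (norm_nonneg _) ((norm_nonneg _).trans h1))

theorem MemHInfty.comp [CompleteSpace D] [CompleteSpace E] {A : UnitAddCircle → D →L[ℂ] E}
    {B : UnitAddCircle → C →L[ℂ] D}
    (hA : MemHInfty A) (hB : MemHInfty B) : MemHInfty (fun t => A t ∘L B t) :=
  (hA.1.comp hB.1).memHInfty fun x => hA.memHTwo (hB.apply x)

theorem memHTwo_const [CompleteSpace E] (x : E) : MemHTwo (fun _ : UnitAddCircle => x) := by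
  refine ⟨memLp_const x, fun n hn => ?_⟩
  have : (fun _ : UnitAddCircle => x) = fun t => (fourier 0 t : ℂ) • x := by simp
  rw [this, fourierCoeff_smul_const, fourierCoeff_fourier]
  simp [hn.ne]

theorem memHInfty_const [CompleteSpace E] (T : D →L[ℂ] E) : MemHInfty (fun _ => T) :=
  (memLInfty_const T).memHInfty fun x => memHTwo_const (T x)

theorem MemHTwo.add {f g : UnitAddCircle → E} (hf : MemHTwo f) (hg : MemHTwo g) :
    MemHTwo (fun t => f t + g t) :=
  ⟨hf.1.add hg.1, fun n hn => by
    rw [fourierCoeff_add hf.integrable hg.integrable, hf.2 n hn, hg.2 n hn, add_zero]⟩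

theorem MemLInfty.add {A B : UnitAddCircle → D →L[ℂ] E} (hA : MemLInfty A) (hB : MemLInfty B) :
    MemLInfty (fun t => A t + B t) := by
  refine ⟨fun x => (hA.1 x).add (hB.1 x), ?_⟩
  obtain ⟨a, ha⟩ := hA.2
  obtain ⟨b, hb⟩ := hB.2
  refine ⟨a + b, ?_⟩
  filter_upwards [ha, hb] with t h1 h2
  exact (norm_add_le _ _).trans (add_le_add h1 h2)

theorem MemHInfty.add {A B : UnitAddCircle → D →L[ℂ] E} (hA : MemHInfty A) (hB : MemHInfty B) :
    MemHInfty (fun t => A t + B t) :=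
  (hA.1.add hB.1).memHInfty fun x => (hA.apply x).add (hB.apply x)

theorem MemHInfty.neg {A : UnitAddCircle → D →L[ℂ] E} (hA : MemHInfty A) :
    MemHInfty (fun t => -A t) := by
  refine ⟨⟨fun x => (hA.1.1 x).neg, by simpa using hA.1.2⟩, fun n hn x => ?_⟩
  have := fourierCoeff.const_smul (fun t => A t x) (-1) n
  rw [hA.2 n hn x] at this
  rw [neg_one_smul, smul_zero] at this
  exact this

theorem MemHInfty.sub {A B : UnitAddCircle → D →L[ℂ] E} (hA : MemHInfty A) (hB : MemHInfty B) :
    MemHInfty (fun t => A t - B t) := by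
  simpa only [sub_eq_add_neg] using hA.add hB.neg

theorem MemLInfty.smul {A : UnitAddCircle → D →L[ℂ] E} (hA : MemLInfty A)
    {b : UnitAddCircle → ℂ} (hb : Continuous b) : MemLInfty (fun t => b t • A t) := by
  refine ⟨fun x => hb.aestronglyMeasurable.smul (hA.1 x), ?_⟩
  obtain ⟨a, ha⟩ := hA.2
  obtain ⟨c, hc⟩ := (isCompact_range hb).isBounded.exists_norm_le
  refine ⟨c * a, ?_⟩
  filter_upwards [ha] with t h1
  rw [norm_smul]
  have h2 := hc (b t) ⟨t, rfl⟩
  exact mul_le_mul h2 h1 (norm_nonneg _) ((norm_nonneg _).trans h2)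

theorem MemLInfty.integrable {A : UnitAddCircle → D →L[ℂ] E} (hA : MemLInfty A) (x : D) :
    Integrable (fun t => A t x) m :=
  (hA.memLp (memLp_const x)).integrable (by norm_num)

/-- The `n`-th Fourier coefficient `x ↦ (A(·)x)^(n)` as a bounded operator. -/
noncomputable def coeffConst (A : UnitAddCircle → D →L[ℂ] E) (hA : MemLInfty A) (n : ℤ) :
    D →L[ℂ] E :=
  LinearMap.mkContinuousOfExistsBound
    { toFun := fun x => fourierCoeff (fun t => A t x) n
      map_add' := fun x y => by
        rw [← fourierCoeff_add (hA.integrable x) (hA.integrable y)]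
        simp
      map_smul' := fun c x => by
        rw [RingHom.id_apply, ← fourierCoeff.const_smul]
        congr 1 with t
        rw [map_smul]
        rfl }
    (hA.2.imp fun C hC x => norm_fourierCoeff_le (by
      filter_upwards [hC] with t ht
      exact le_of_opNorm_le _ ht x) n)

end Hardy

/-! ### Scalar Blaschke factors and evaluation at a point of the disc. -/

section BlaschkeFactors

variable {D : Type*} [NormedAddCommGroup D] [InnerProductSpace ℂ D]
variable {E : Type*} [NormedAddCommGroup E] [InnerProductSpace ℂ E] [CompleteSpace E]

/-- The Blaschke factor `b_α` as a function on the circle. -/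
noncomputable def circleBlaschke (α : ℂ) (t : UnitAddCircle) : ℂ := blaschkeFactor α (coord t)

theorem one_sub_conj_mul_coord_ne_zero {α : ℂ} (hα : ‖α‖ < 1) (t : UnitAddCircle) :
    1 - conj α * coord t ≠ 0 := by
  intro h
  have h1 := congrArg norm (sub_eq_zero.1 h)
  rw [norm_mul, RCLike.norm_conj, norm_coord, norm_one] at h1
  linarith

theorem circleBlaschke_mul {α : ℂ} (hα : ‖α‖ < 1) (t : UnitAddCircle) :
    (1 - conj α * coord t) * circleBlaschke α t = coord t - α :=
  mul_div_cancel₀ _ (one_sub_conj_mul_coord_ne_zero hα t)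

/-- On the circle conj b_α is 1/b_α. Cleared of denominators, this yields linear recurrences between
Fourier coefficients. -/
theorem mul_conj_circleBlaschke {α : ℂ} (hα : ‖α‖ < 1) (t : UnitAddCircle) :
    (coord t - α) * conj (circleBlaschke α t) = 1 - conj α * coord t := by
  have h := congrArg conj (circleBlaschke_mul hα t)
  simp only [map_mul, map_sub, map_one, Complex.conj_conj] at h
  linear_combination (coord t) * h + (α * conj (circleBlaschke α t) + 1) * conj_coord_mul t

theorem conj_circleBlaschke_mul_self {α : ℂ} (hα : ‖α‖ < 1) (t : UnitAddCircle) :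
    conj (circleBlaschke α t) * circleBlaschke α t = 1 := by
  refine mul_left_cancel₀ (one_sub_conj_mul_coord_ne_zero hα t) ?_
  linear_combination conj (circleBlaschke α t) * circleBlaschke_mul hα t +
    mul_conj_circleBlaschke hα t

theorem norm_circleBlaschke {α : ℂ} (hα : ‖α‖ < 1) (t : UnitAddCircle) :
    ‖circleBlaschke α t‖ = 1 := by
  have h := congrArg norm (conj_circleBlaschke_mul_self hα t)
  rw [norm_mul, RCLike.norm_conj, norm_one] at h
  nlinarith [norm_nonneg (circleBlaschke α t)]

theorem circleBlaschke_neg (α : ℂ) (t : UnitAddCircle) :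
    circleBlaschke α (-t) = conj (circleBlaschke (conj α) t) := by
  simp [circleBlaschke, blaschkeFactor, coord_neg]

theorem continuous_circleBlaschke {α : ℂ} (hα : ‖α‖ < 1) : Continuous (circleBlaschke α) :=
  (continuous_coord.sub continuous_const).div
    (continuous_const.sub (continuous_const.mul continuous_coord))
    (one_sub_conj_mul_coord_ne_zero hα)

theorem integrable_circleBlaschke {α : ℂ} (hα : ‖α‖ < 1) : Integrable (circleBlaschke α) m :=
  .of_bound (continuous_circleBlaschke hα).aestronglyMeasurable 1
    (.of_forall fun t => (norm_circleBlaschke hα t).le)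

theorem fourierCoeff_circleBlaschke_recurrence {α : ℂ} (hα : ‖α‖ < 1) (n : ℤ) :
    fourierCoeff (circleBlaschke α) n - conj α * fourierCoeff (circleBlaschke α) (n - 1) =
      (if n = 1 then 1 else 0) - α * (if n = 0 then 1 else 0) := by
  have h := fourierCoeff_one_sub_mul_coord_smul (integrable_circleBlaschke hα) (conj α) n
  simp only [smul_eq_mul, circleBlaschke_mul hα] at h
  rw [← h]
  have h2 := fourierCoeff_coord_sub_smul
    (integrable_const (1 : ℂ) : Integrable (fun _ : UnitAddCircle => (1 : ℂ)) m) α n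
  simp only [smul_eq_mul, mul_one] at h2
  have h3 : (fun _ : UnitAddCircle => (1 : ℂ)) = fourier 0 := by ext; simp
  rw [h2, h3, fourierCoeff_fourier, Pi.single_apply, Pi.single_apply]
  simp only [sub_eq_zero]

/-- Below index 0 the recurrence is homogeneous with ratio conj α. A coefficient is thus (conj α)ᵏ
times another one bounded by 1, for every k. -/
theorem fourierCoeff_circleBlaschke_of_neg {α : ℂ} (hα : ‖α‖ < 1) {n : ℤ} (hn : n < 0) :
    fourierCoeff (circleBlaschke α) n = 0 := by
  have hrec : ∀ k : ℕ, fourierCoeff (circleBlaschke α) n =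
      conj α ^ k * fourierCoeff (circleBlaschke α) (n - k) := by
    intro k
    induction k with
    | zero => simp
    | succ k ih =>
      have h := fourierCoeff_circleBlaschke_recurrence hα (n - k)
      rw [if_neg (by omega), if_neg (by omega), mul_zero, sub_zero, sub_eq_zero] at h
      rw [ih, h, pow_succ, mul_assoc]
      congr 3
      push_cast
      ring
  have hlim : Filter.Tendsto (fun k : ℕ => ‖α‖ ^ k) Filter.atTop (nhds 0) :=
    tendsto_pow_atTop_nhds_zero_of_lt_one (norm_nonneg _) hα
  refine norm_le_zero_iff.1 (ge_of_tendsto' hlim fun k => ?_)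
  rw [hrec k, norm_mul, norm_pow, RCLike.norm_conj]
  exact mul_le_of_le_one_right (by positivity)
    (norm_fourierCoeff_le (.of_forall fun t => (norm_circleBlaschke hα t).le) _)

theorem fourierCoeff_conj_circleBlaschke {α : ℂ} (hα : ‖α‖ < 1) :
    fourierCoeff (fun t => conj (circleBlaschke α t)) (-1) = 1 - α * conj α := by
  have h0 := fourierCoeff_circleBlaschke_recurrence hα 0
  have h1 := fourierCoeff_circleBlaschke_recurrence hα 1
  rw [fourierCoeff_circleBlaschke_of_neg hα (n := 0 - 1) (by norm_num), if_neg (by norm_num), if_pos rfl,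
    mul_zero, sub_zero, zero_sub, mul_one] at h0
  rw [if_pos rfl, if_neg (by norm_num), mul_zero, sub_zero, sub_self, h0] at h1
  rw [fourierCoeff_conj, neg_neg, sub_eq_iff_eq_add.1 h1]
  simp only [map_add, map_one, map_mul, map_neg, Complex.conj_conj]
  ring

theorem memHInfty_circleBlaschke {α : ℂ} (hα : ‖α‖ < 1) :
    MemHInfty (fun t => circleBlaschke α t • ContinuousLinearMap.id ℂ E) :=
  ⟨(memLInfty_const _).smul (continuous_circleBlaschke hα), fun n hn x => by
    change fourierCoeff (fun t => circleBlaschke α t • x) n = 0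
    rw [fourierCoeff_smul_const, fourierCoeff_circleBlaschke_of_neg hα hn, zero_smul]⟩

theorem MemHInfty.circleBlaschke_smul {F : UnitAddCircle → D →L[ℂ] E}
    (hF : MemHInfty F) {α : ℂ} (hα : ‖α‖ < 1) :
    MemHInfty (fun t => circleBlaschke α t • F t) := by
  simpa using (memHInfty_circleBlaschke (E := E) hα).comp hF

/-- `F - F(α)` is divisible by `b_α` in `H^∞`; here `T` is the value `F(α)`. -/
theorem MemHInfty.exists_evaluation {F : UnitAddCircle → D →L[ℂ] E} (hF : MemHInfty F) {α : ℂ}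
    (hα : ‖α‖ < 1) :
    ∃ T : D →L[ℂ] E, MemHInfty (fun t => conj (circleBlaschke α t) • (F t - T)) := by
  have hbc : Continuous fun t => conj (circleBlaschke α t) :=
    Complex.continuous_conj.comp (continuous_circleBlaschke hα)
  have hG := hF.1.smul hbc
  have hGi : ∀ x, Integrable (fun t => conj (circleBlaschke α t) • F t x) m := fun x =>
    (hG.memLp (memLp_const x)).integrable (by norm_num)
  set ℓ : D →L[ℂ] E := coeffConst _ hG (-1)
  have hℓ : ∀ x, ℓ x = fourierCoeff (fun t => conj (circleBlaschke α t) • F t x) (-1) :=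
    fun _ => rfl
  set c : ℂ := 1 - α * conj α with hc
  have hc0 : c ≠ 0 := by
    intro h
    have h1 := congrArg norm (sub_eq_zero.1 h)
    rw [norm_mul, RCLike.norm_conj, norm_one] at h1
    nlinarith [norm_nonneg α]
  -- At index -1, conj b_α • F has coefficient ℓ and conj b_α has coefficient c = 1 - |α|². This
  -- constant is the one whose subtraction from F kills the coefficient at -1.
  refine ⟨c⁻¹ • ℓ, ?_⟩
  have hH := hF.sub (memHInfty_const (c⁻¹ • ℓ))
  refine ⟨hH.1.smul hbc, fun n hn x => ?_⟩
  have hi : Integrable (fun t => (conj (circleBlaschke α t) • (F t - c⁻¹ • ℓ)) x) m :=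
    ((hH.1.smul hbc).memLp (memLp_const x)).integrable (by norm_num)
  -- Multiplication by z - α turns conj b_α into 1 - conj α z and gives an analytic function. So the
  -- negative coefficients form a geometric progression, which vanishes once its term at -1 does.
  have hstep : ∀ n : ℤ, n < 0 →
      fourierCoeff (fun t => (conj (circleBlaschke α t) • (F t - c⁻¹ • ℓ)) x) (n - 1) =
        α • fourierCoeff (fun t => (conj (circleBlaschke α t) • (F t - c⁻¹ • ℓ)) x) n := by
    intro n hn
    rw [← sub_eq_zero, ← fourierCoeff_coord_sub_smul hi]
    have : (fun t => (coord t - α) • (conj (circleBlaschke α t) • (F t - c⁻¹ • ℓ)) x) =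
        fun t => (1 - conj α * coord t) • (F t - c⁻¹ • ℓ) x := by
      ext t
      rw [smul_apply, smul_smul, mul_conj_circleBlaschke hα]
    rw [this, fourierCoeff_one_sub_mul_coord_smul (hH.apply x).integrable, hH.2 n hn x,
      hH.2 (n - 1) (by omega) x, smul_zero, sub_zero]
  have hfirst : fourierCoeff (fun t => (conj (circleBlaschke α t) • (F t - c⁻¹ • ℓ)) x) (-1) = 0 := by
    have h1 : (fun t => (conj (circleBlaschke α t) • (F t - c⁻¹ • ℓ)) x) = fun t =>
        conj (circleBlaschke α t) • F t x - conj (circleBlaschke α t) • (c⁻¹ • ℓ x) := by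
      ext t
      simp [smul_sub]
    have h2 : Integrable (fun t => conj (circleBlaschke α t) • (c⁻¹ • ℓ x)) m :=
      .of_bound (hbc.aestronglyMeasurable.smul aestronglyMeasurable_const) ‖c⁻¹ • ℓ x‖
        (.of_forall fun t => by
          rw [norm_smul, RCLike.norm_conj, norm_circleBlaschke hα, one_mul])
    rw [h1, fourierCoeff_sub (hGi x) h2, fourierCoeff_smul_const,
      fourierCoeff_conj_circleBlaschke hα, ← hc, smul_inv_smul₀ hc0, hℓ, sub_self]
  obtain ⟨k, rfl⟩ : ∃ k : ℕ, n = -1 - k := ⟨(-1 - n).toNat, by omega⟩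
  clear hn
  induction k with
  | zero => simpa using hfirst
  | succ k ih =>
    have := hstep (-1 - k) (by omega)
    rw [ih, smul_zero] at this
    rw [← this]
    congr 1
    push_cast
    ring

end BlaschkeFactors

/-! ### Adjoints, constant inner functions and the tilde operation. -/

section Adjoints

variable {D : Type*} [NormedAddCommGroup D] [InnerProductSpace ℂ D] [CompleteSpace D]
variable {E : Type*} [NormedAddCommGroup E] [InnerProductSpace ℂ E] [CompleteSpace E]

/-- The adjoint on the circle reverses the order of the Fourier coefficients. -/
theorem inner_fourierCoeff_adjoint {F : UnitAddCircle → D →L[ℂ] E}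
    {G : UnitAddCircle → E →L[ℂ] D} (hF : MemLInfty F) (hG : MemLInfty G)
    (h : ∀ᵐ t ∂m, G t = adjoint (F t)) (x : D) (y : E) (n : ℤ) :
    ⟪x, fourierCoeff (fun t => G t y) n⟫_ℂ =
      conj ⟪y, fourierCoeff (fun t => F t x) (-n)⟫_ℂ := by
  rw [← fourierCoeff_inner ((hF.memLp (memLp_const x)).integrable (by norm_num)),
    ← fourierCoeff_inner ((hG.memLp (memLp_const y)).integrable (by norm_num)),
    ← fourierCoeff_conj]
  refine congrFun (fourierCoeff_congr_ae ?_) n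
  filter_upwards [h] with t ht
  rw [ht, adjoint_inner_right, inner_conj_symm]

/-- A function which is analytic together with its adjoint is constant. -/
theorem MemHInfty.ae_eq_const {F : UnitAddCircle → D →L[ℂ] E} {G : UnitAddCircle → E →L[ℂ] D}
    (hF : MemHInfty F) (hG : MemHInfty G) (h : ∀ᵐ t ∂m, G t = adjoint (F t)) (y : E) :
    ∀ᵐ t ∂m, G t y = fourierCoeff (fun t => G t y) 0 := by
  refine ae_eq_const_of_fourierCoeff (hG.apply y).1 fun n hn => ?_
  rcases lt_or_gt_of_ne hn with hn | hn
  · exact hG.2 n hn y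
  · refine ext_inner_left ℂ fun x => ?_
    rw [inner_fourierCoeff_adjoint hF.1 hG.1 h, hF.2 _ (by omega), inner_zero_right, map_zero,
      inner_zero_right]

/-- An isometry with a right inverse is unitary, and that inverse is its adjoint. So X and X* are
both analytic, which forces them to be constant. -/
theorem isUnitaryConstant_of_inner {X : UnitAddCircle → D →L[ℂ] E}
    {B : UnitAddCircle → E →L[ℂ] D} (hX : IsInner X) (hB : MemHInfty B)
    (h : ∀ᵐ t ∂m, X t ∘L B t = ContinuousLinearMap.id ℂ E) : IsUnitaryConstant X := by
  have hBX : ∀ᵐ t ∂m, B t = adjoint (X t) := by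
    filter_upwards [h, hX.2] with t h1 h2
    rw [← ContinuousLinearMap.id_comp (B t), ← h2, ContinuousLinearMap.comp_assoc, h1,
      ContinuousLinearMap.comp_id]
  have hXB : ∀ᵐ t ∂m, X t = adjoint (B t) := by
    filter_upwards [hBX] with t ht
    rw [ht, adjoint_adjoint]
  have hXc := hB.ae_eq_const hX.1 hXB
  have hBc := hX.1.ae_eq_const hB hBX
  let U : D →ₗᵢ[ℂ] E :=
    { toLinearMap := (coeffConst X hX.1.1 0 : D →ₗ[ℂ] E)
      norm_map' := fun x => by
        obtain ⟨t, h1, h2⟩ := ((hXc x).and hX.2).exists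
        refine (congrArg norm h1).symm.trans ?_
        exact ((X t).norm_map_iff_adjoint_comp_self).2 h2 x }
  have hsurj : Function.Surjective U := fun y => by
    refine ⟨fourierCoeff (fun t => B t y) 0, ?_⟩
    obtain ⟨t, h1, h2, h3⟩ := ((hBc y).and (h.and (hXc (fourierCoeff (fun t => B t y) 0)))).exists
    refine h3.symm.trans ?_
    rw [← h1]
    exact congrArg (· y) h2
  exact ⟨LinearIsometryEquiv.ofSurjective U hsurj, hXc⟩

/-- The adjoint and the reflection of the circle each reverse the order of the coefficients, so
together they preserve analyticity. -/
theorem MemHInfty.tilde {F : UnitAddCircle → D →L[ℂ] E} (hF : MemHInfty F)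
    (hm : ∀ y, AEStronglyMeasurable (fun t => adjoint (F t) y) m) : MemHInfty (tilde F) := by
  have hG : MemLInfty fun t => adjoint (F t) := ⟨hm, hF.1.2.imp fun C hC => by
    filter_upwards [hC] with t ht
    rwa [LinearIsometryEquiv.norm_map]⟩
  have hmp := Measure.measurePreserving_neg (m : Measure UnitAddCircle)
  refine ⟨⟨fun y => ?_, ?_⟩, fun n hn y => ?_⟩
  · exact AEStronglyMeasurable.comp_measurePreserving (f := fun t => -t) (hm y) hmp
  · obtain ⟨C, hC⟩ := hG.2
    exact ⟨C, hmp.quasiMeasurePreserving.ae (p := fun t => ‖adjoint (F t)‖ ≤ C) hC⟩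
  · change fourierCoeff (fun t => adjoint (F (-t)) y) n = 0
    rw [fourierCoeff_comp_neg (fun t => adjoint (F t) y)]
    refine ext_inner_left ℂ fun x => ?_
    rw [inner_fourierCoeff_adjoint hF.1 hG (.of_forall fun _ => rfl), neg_neg, hF.2 n hn,
      inner_zero_right, map_zero, inner_zero_right]

theorem tilde_tilde (F : UnitAddCircle → D →L[ℂ] E) :
    OperatorHardy.tilde (OperatorHardy.tilde F) = F := by
  ext t x
  simp [OperatorHardy.tilde]

end Adjoints

universe u v

/-! ### Blaschke–Potapov products. -/

section Potapov

variable {E : Type*} [NormedAddCommGroup E] [InnerProductSpace ℂ E] [CompleteSpace E]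

/-- The elementary Blaschke-Potapov factor `b_α P + (I - P)`. -/
noncomputable def potapovFactor (p : ℂ × (E →L[ℂ] E)) (t : UnitAddCircle) : E →L[ℂ] E :=
  circleBlaschke p.1 t • p.2 + (1 - p.2)

/-- The product of the elementary Blaschke-Potapov factors in a list. -/
noncomputable def potapovProd (L : List (ℂ × (E →L[ℂ] E))) (t : UnitAddCircle) : E →L[ℂ] E :=
  (L.map fun p => potapovFactor p t).prod

/-- The scalar Blaschke product with zeros in a list. -/
noncomputable def blaschkeProd (l : List ℂ) (t : UnitAddCircle) : ℂ :=
  (l.map fun α => circleBlaschke α t).prod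

/-- The admissible data for Blaschke-Potapov products. -/
def IsPotapovList (L : List (ℂ × (E →L[ℂ] E))) : Prop :=
  ∀ p ∈ L, ‖p.1‖ < 1 ∧ IsStarProjection p.2

theorem norm_blaschkeProd {l : List ℂ} (hl : ∀ α ∈ l, ‖α‖ < 1) (t : UnitAddCircle) :
    ‖blaschkeProd l t‖ = 1 := by
  induction l with
  | nil => simp [blaschkeProd]
  | cons α l ih =>
    rw [List.forall_mem_cons] at hl
    have := ih hl.2
    simp only [blaschkeProd, List.map_cons, List.prod_cons, norm_mul] at this ⊢
    rw [norm_circleBlaschke hl.1, this, one_mul]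

theorem conj_blaschkeProd_mul_self {l : List ℂ} (hl : ∀ α ∈ l, ‖α‖ < 1) (t : UnitAddCircle) :
    conj (blaschkeProd l t) * blaschkeProd l t = 1 := by
  rw [← Complex.normSq_eq_conj_mul_self, Complex.normSq_eq_norm_sq, norm_blaschkeProd hl]
  simp

theorem blaschkeProd_neg (l : List ℂ) (t : UnitAddCircle) :
    blaschkeProd (l.map conj) (-t) = conj (blaschkeProd l t) := by
  induction l with
  | nil => simp [blaschkeProd]
  | cons α l ih =>
    simp only [blaschkeProd, List.map_cons, List.prod_cons, map_mul] at ih ⊢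
    rw [ih, circleBlaschke_neg, Complex.conj_conj]

theorem MemHInfty.blaschkeProd_smul {D : Type*} [NormedAddCommGroup D] [InnerProductSpace ℂ D]
    {F : UnitAddCircle → D →L[ℂ] E} (hF : MemHInfty F) {l : List ℂ} (hl : ∀ α ∈ l, ‖α‖ < 1) :
    MemHInfty (fun t => blaschkeProd l t • F t) := by
  induction l with
  | nil => simpa [blaschkeProd] using hF
  | cons α l ih =>
    rw [List.forall_mem_cons] at hl
    simpa only [blaschkeProd, List.map_cons, List.prod_cons, mul_smul] using
      (ih hl.2).circleBlaschke_smul hl.1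

theorem memHInfty_potapovFactor {p : ℂ × (E →L[ℂ] E)} (hp : ‖p.1‖ < 1) :
    MemHInfty (potapovFactor p) :=
  ((memHInfty_const _).circleBlaschke_smul hp).add (memHInfty_const _)

theorem potapovFactor_apply {E : Type*} [NormedAddCommGroup E] [InnerProductSpace ℂ E]
    (p : ℂ × (E →L[ℂ] E)) (t : UnitAddCircle) (y : E) :
    potapovFactor p t y = circleBlaschke p.1 t • p.2 y + (y - p.2 y) := rfl

/-- On the range of P the factors act as b_α and 1, on its kernel as 1 and b_α. -/
theorem potapovFactor_mul (α : ℂ) {P : E →L[ℂ] E} (hP : IsStarProjection P) (t : UnitAddCircle) :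
    potapovFactor (α, P) t * potapovFactor (α, 1 - P) t = circleBlaschke α t • 1 := by
  ext y
  have hPP : P (P y) = P y := congrArg (· y) hP.isIdempotentElem.eq
  change potapovFactor (α, P) t (potapovFactor (α, 1 - P) t y) = circleBlaschke α t • y
  have h1 : (1 - P) y = y - P y := rfl
  simp only [potapovFactor_apply, h1, map_add, map_smul, map_sub, hPP]
  module

theorem adjoint_potapovFactor_mul_self {p : ℂ × (E →L[ℂ] E)} (hp : ‖p.1‖ < 1)
    (hP : IsStarProjection p.2) (t : UnitAddCircle) :
    adjoint (potapovFactor p t) * potapovFactor p t = 1 := by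
  have h : adjoint p.2 = p.2 := hP.isSelfAdjoint
  have h1 : adjoint (1 : E →L[ℂ] E) = 1 := star_one _
  have hPP : ∀ y, p.2 (p.2 y) = p.2 y := fun y => congrArg (· y) hP.isIdempotentElem.eq
  have ha : ∀ y, adjoint (potapovFactor p t) y =
      conj (circleBlaschke p.1 t) • p.2 y + (y - p.2 y) := fun y => by
    rw [potapovFactor, map_add, map_sub, map_smulₛₗ, h, h1]
    rfl
  ext y
  change adjoint (potapovFactor p t) (potapovFactor p t y) = y
  simp only [ha, potapovFactor_apply, map_add, map_smul, map_sub, hPP]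
  linear_combination (norm := module) conj_circleBlaschke_mul_self hp t • p.2 y

theorem adjoint_potapovProd_mul_self {L : List (ℂ × (E →L[ℂ] E))} (hL : IsPotapovList L)
    (t : UnitAddCircle) : adjoint (potapovProd L t) * potapovProd L t = 1 := by
  induction L with
  | nil =>
    have h1 : adjoint (1 : E →L[ℂ] E) = 1 := star_one _
    simp [potapovProd, h1]
  | cons p L ih =>
    rw [IsPotapovList, List.forall_mem_cons] at hL
    have h : adjoint (potapovProd (p :: L) t) =
        adjoint (potapovProd L t) * adjoint (potapovFactor p t) := adjoint_comp _ _
    have h2 : potapovProd (p :: L) t = potapovFactor p t * potapovProd L t := rfl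
    rw [h, h2, mul_assoc, ← mul_assoc (adjoint (potapovFactor p t)),
      adjoint_potapovFactor_mul_self hL.1.1 hL.1.2, one_mul, ih hL.2]

theorem tilde_potapovFactor {p : ℂ × (E →L[ℂ] E)} (hp : IsStarProjection p.2) :
    tilde (potapovFactor p) = potapovFactor (conj p.1, p.2) := by
  have h : adjoint p.2 = p.2 := hp.isSelfAdjoint
  have h1 : adjoint (1 : E →L[ℂ] E) = 1 := star_one _
  ext1 t
  simp only [tilde, potapovFactor, circleBlaschke_neg, map_add, map_sub, map_smulₛₗ,
    Complex.conj_conj, h, h1]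

theorem tilde_potapovProd {L : List (ℂ × (E →L[ℂ] E))} (hL : IsPotapovList L) :
    tilde (potapovProd L) = potapovProd (L.map fun p => (conj p.1, p.2)).reverse := by
  ext1 t
  induction L with
  | nil => exact star_one _
  | cons p L ih =>
    rw [IsPotapovList, List.forall_mem_cons] at hL
    have h := ih hL.2
    have h2 := congrFun (tilde_potapovFactor hL.1.2) t
    simp only [tilde, potapovProd, List.map_cons, List.prod_cons, List.reverse_cons,
      List.map_append, List.prod_append, List.map_nil, List.prod_nil, mul_one] at h h2 ⊢
    rw [← h, ← h2]
    exact adjoint_comp _ _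

theorem IsPotapovList.tilde {L : List (ℂ × (E →L[ℂ] E))} (hL : IsPotapovList L) :
    IsPotapovList (L.map fun p => (conj p.1, p.2)).reverse := by
  intro p hp
  obtain ⟨q, hq, rfl⟩ := List.mem_map.1 (List.mem_reverse.1 hp)
  exact ⟨by simpa using (hL q hq).1, (hL q hq).2⟩

theorem IsPotapovList.isFiniteBlaschkePotapovProduct {L : List (ℂ × (E →L[ℂ] E))}
    (hL : IsPotapovList L) : IsFiniteBlaschkePotapovProduct (potapovProd L) := by
  refine ⟨1, L.length, fun i => (L.get i).1, fun i => (L.get i).2, one_mem _,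
    fun i => (hL _ (L.get_mem i)).1, fun i => (hL _ (L.get_mem i)).2, .of_forall fun t => ?_⟩
  rw [one_mul, potapovProd]
  congr 1
  conv_lhs => rw [← List.ofFn_get L, List.map_ofFn]
  rfl

/-- For one factor, b(bP + (1 - P))* = P + b(1 - P) because |b| = 1. Being scalar, the Blaschke
factors can be distributed over the reversed product. -/
theorem memHInfty_blaschkeProd_smul_adjoint {L : List (ℂ × (E →L[ℂ] E))} (hL : IsPotapovList L) :
    MemHInfty (fun t => blaschkeProd (L.map Prod.fst) t • adjoint (potapovProd L t)) := by
  induction L with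
  | nil => simpa [blaschkeProd, potapovProd] using memHInfty_const (adjoint (1 : E →L[ℂ] E))
  | cons p L ih =>
    rw [IsPotapovList, List.forall_mem_cons] at hL
    have h : adjoint p.2 = p.2 := hL.1.2.isSelfAdjoint
    have h1 : adjoint (1 : E →L[ℂ] E) = 1 := star_one _
    have hf : MemHInfty fun t => circleBlaschke p.1 t • adjoint (potapovFactor p t) := by
      have : (fun t => circleBlaschke p.1 t • adjoint (potapovFactor p t)) =
          fun t => p.2 + circleBlaschke p.1 t • (1 - p.2) := by
        ext1 t
        simp only [potapovFactor, map_add, map_sub, map_smulₛₗ, h, h1, smul_add, smul_smul]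
        rw [mul_comm, conj_circleBlaschke_mul_self hL.1.1, one_smul]
      rw [this]
      exact (memHInfty_const _).add ((memHInfty_const _).circleBlaschke_smul hL.1.1)
    refine ((ih hL.2).comp hf).congr (.of_forall fun t => ?_)
    have : potapovProd (p :: L) t = potapovFactor p t ∘L potapovProd L t := rfl
    simp only [this, blaschkeProd, List.map_cons, List.prod_cons, adjoint_comp]
    rw [ContinuousLinearMap.comp_smul, ContinuousLinearMap.smul_comp, smul_smul]

end Potapov

/-! ### Extraction of the common left divisor. -/

section Coprime

variable {D : Type v} [NormedAddCommGroup D] [InnerProductSpace ℂ D]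
variable {E : Type u} [NormedAddCommGroup E] [InnerProductSpace ℂ E] [CompleteSpace E]

theorem leftCoprime_one [CompleteSpace D] (Ψ : UnitAddCircle → D →L[ℂ] E) :
    LeftCoprime (potapovProd ([] : List (ℂ × (E →L[ℂ] E)))) Ψ := by
  rintro D' _ _ _ X ⟨hX, B, hB, h⟩ -
  exact isUnitaryConstant_of_inner hX hB (h.mono fun t ht => ht.symm)

/-- If `conj b_α G T` is analytic for a constant `T`, so is `conj b_α G Q` where `Q` is the
projection onto the closure of the range of `T`. -/
theorem MemLInfty.memHInfty_comp_starProjection {C : Type*} [NormedAddCommGroup C]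
    [InnerProductSpace ℂ C] [CompleteSpace C] {G : UnitAddCircle → E →L[ℂ] C} (hG : MemLInfty G)
    {T : D →L[ℂ] E} (h : MemHInfty fun t => G t ∘L T) :
    MemHInfty fun t => G t ∘L T.range.topologicalClosure.starProjection := by
  refine ⟨hG.comp (memLInfty_const _), fun n hn x => ?_⟩
  have hle : T.range.topologicalClosure ≤ (coeffConst G hG n).ker := by
    refine Submodule.topologicalClosure_minimal _ ?_ (ContinuousLinearMap.isClosed_ker _)
    rintro _ ⟨y, rfl⟩
    exact h.2 n hn y
  exact hle (Submodule.starProjection_apply_mem _ x)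

/-- Ω is the divisor shared by Ψ and the scalar Blaschke product ϑI; the quotients Ψ' and Δ =
`potapovProd L` have no common left inner divisor except unitary constants. -/
theorem exists_coprime_factorization [CompleteSpace D] {l : List ℂ} (hl : ∀ α ∈ l, ‖α‖ < 1)
    {Ψ : UnitAddCircle → D →L[ℂ] E} (hΨ : MemHInfty Ψ) :
    ∃ (Ω : UnitAddCircle → E →L[ℂ] E) (L : List (ℂ × (E →L[ℂ] E)))
      (Ψ' : UnitAddCircle → D →L[ℂ] E),
      MemHInfty Ω ∧ IsPotapovList L ∧ MemHInfty Ψ' ∧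
      (∀ t, Ω t * potapovProd L t = blaschkeProd l t • 1) ∧
      (∀ t, potapovProd L t * Ω t = blaschkeProd l t • 1) ∧
      (∀ t, Ψ t = Ω t ∘L Ψ' t) ∧ LeftCoprime (potapovProd L) Ψ' := by
  induction l generalizing Ψ with
  | nil =>
    exact ⟨fun _ => 1, [], Ψ, memHInfty_const _, by simp [IsPotapovList], hΨ,
      by simp [potapovProd, blaschkeProd], by simp [potapovProd, blaschkeProd],
      fun t => (ContinuousLinearMap.id_comp _).symm, leftCoprime_one Ψ⟩
  | cons α l ih =>
    rw [List.forall_mem_cons] at hl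
    obtain ⟨hα, hl⟩ := hl
    obtain ⟨T, hT⟩ := hΨ.exists_evaluation hα
    set Q : E →L[ℂ] E := T.range.topologicalClosure.starProjection with hQ
    have hQp : IsStarProjection Q := isStarProjection_starProjection
    have hQQ : ∀ y, Q (Q y) = Q y := fun y => congrArg (· y) hQp.isIdempotentElem.eq
    have hP : ∀ y, (1 - Q) y = y - Q y := fun _ => rfl
    have hQT : ∀ x, Q (T x) = T x := fun x => Submodule.starProjection_eq_self_iff.2
      (Submodule.le_topologicalClosure _ ⟨x, rfl⟩)
    have hb : ∀ t, conj (circleBlaschke α t) * circleBlaschke α t = 1 :=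
      conj_circleBlaschke_mul_self hα
    set b := circleBlaschke α with hbdef
    -- This is the quotient of Ψ by b(1 - Q) + Q. It is analytic because (1 - Q)T = 0, so
    -- subtracting T leaves (1 - Q)Ψ unchanged.
    have hΨ₁ : MemHInfty fun t => (1 - Q) ∘L (conj (b t) • (Ψ t - T)) + Q ∘L Ψ t :=
      ((memHInfty_const _).comp hT).add ((memHInfty_const _).comp hΨ)
    obtain ⟨Ω₁, L, Ψ', hΩ₁, hL, hΨ', hΩL, hLΩ, hfac, hco⟩ := ih hl hΨ₁
    have hfac' : ∀ t x, Ω₁ t (Ψ' t x) =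
        conj (b t) • Ψ t x - conj (b t) • Q (Ψ t x) + Q (Ψ t x) := by
      intro t x
      have := congrArg (· x) (hfac t)
      simp only [comp_apply] at this
      rw [← this]
      simp [hQT, smul_sub]
    have hprod : ∀ t, potapovProd (L ++ [(α, Q)]) t = potapovProd L t * potapovFactor (α, Q) t := by
      intro t
      simp [potapovProd]
    have hbl : ∀ t, blaschkeProd (α :: l) t = b t * blaschkeProd l t := fun t => by
      simp [blaschkeProd, hbdef]
    have hPQ : ∀ t, potapovFactor (α, 1 - Q) t * potapovFactor (α, Q) t = b t • 1 := by
      simpa using potapovFactor_mul (E := E) α hQp.one_sub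
    have hQP := potapovFactor_mul α hQp
    obtain ⟨Ω, hΩdef⟩ : ∃ Ω : UnitAddCircle → E →L[ℂ] E,
      ∀ t, Ω t = potapovFactor (α, 1 - Q) t * Ω₁ t := ⟨_, fun _ => rfl⟩
    have hΩ : MemHInfty Ω := ((memHInfty_potapovFactor (p := (α, 1 - Q)) hα).comp hΩ₁).congr
      (.of_forall fun t => (hΩdef t).symm)
    refine ⟨Ω, L ++ [(α, Q)], Ψ', hΩ, ?_, hΨ', fun t => ?_, fun t => ?_, fun t => ?_, ?_⟩
    · intro p hp
      rcases List.mem_append.1 hp with hp | hp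
      · exact hL p hp
      · rw [List.mem_singleton.1 hp]
        exact ⟨hα, hQp⟩
    · calc _ = potapovFactor (α, 1 - Q) t * (Ω₁ t * potapovProd L t) * potapovFactor (α, Q) t := by
            rw [hprod, hΩdef]; simp only [mul_assoc]
        _ = _ := by rw [hΩL, mul_smul_comm, mul_one, smul_mul_assoc, hPQ, hbl, smul_smul, mul_comm]
    · calc _ = potapovProd L t * (potapovFactor (α, Q) t * potapovFactor (α, 1 - Q) t) * Ω₁ t := by
            rw [hprod, hΩdef]; simp only [mul_assoc]
        _ = _ := by rw [hQP, mul_smul_comm, mul_one, smul_mul_assoc, hLΩ, hbl, smul_smul]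
    · ext x
      rw [hΩdef]
      change Ψ t x = potapovFactor (α, 1 - Q) t (Ω₁ t (Ψ' t x))
      simp only [hfac', potapovFactor_apply, hP, map_add, map_smul, map_sub, hQQ, ← hbdef]
      linear_combination (norm := module) (hb t) • (Q (Ψ t x) - Ψ t x)
    -- The aim is that X also divides the shorter product `potapovProd L`, so that `hco` applies.
    -- The candidate cofactor is B₁(1 - Q) + conj b • B₁Q, and only its second term may fail to be
    -- analytic.
    · rintro D' _ _ _ X ⟨hX, B₁, hB₁, hXB₁⟩ ⟨-, B₂, hB₂, hXB₂⟩
      have hbc : Continuous fun t => conj (b t) :=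
        Complex.continuous_conj.comp (continuous_circleBlaschke hα)
      have hΔ : ∀ᵐ t ∂m, ∀ y, X t (B₁ t y) = potapovProd L t (b t • Q y + (y - Q y)) := by
        filter_upwards [hXB₁] with t ht y
        have := congrArg (· y) ht
        rw [hprod] at this
        exact this.symm
      have hBP : MemHInfty fun t => B₁ t ∘L (1 - Q) := hB₁.comp (memHInfty_const _)
      have hBQ : MemHInfty fun t => B₁ t ∘L Q := hB₁.comp (memHInfty_const _)
      -- Write Ψ₁ for the function in `hΨ₁`, Δ for `potapovProd L` and ϑ for `blaschkeProd l`. From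
      -- ϑΨ' = ΔΨ₁ and QΨ₁ = QΨ one gets X(ϑB₂ - B₁(1 - Q)Ψ₁) = X(conj b • B₁QΨ), and the isometry X
      -- cancels.
      have hBQΨ : MemHInfty fun t => conj (b t) • (B₁ t ∘L Q) ∘L Ψ t := by
        refine ((hB₂.blaschkeProd_smul hl).sub (hBP.comp (hΨ₁))).congr ?_
        filter_upwards [hΔ, hXB₂, hX.2] with t h1 h2 h3
        have hinj : Function.Injective (X t) :=
          Function.LeftInverse.injective (g := adjoint (X t)) fun x => congrArg (· x) h3
        ext x
        apply hinj
        have h2x : X t (B₂ t x) = Ψ' t x := (congrArg (· x) h2).symm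
        have h4 : potapovProd L t (Ω₁ t (Ψ' t x)) = blaschkeProd l t • Ψ' t x :=
          congrArg (· (Ψ' t x)) (hLΩ t)
        rw [hfac'] at h4
        simp only [sub_apply, smul_apply, comp_apply, map_sub, map_smul, h2x, ← h4, h1, hP,
          add_apply, map_add, hQQ, hQT, sub_self, smul_zero, map_zero]
        linear_combination (norm := module) -((hb t) • potapovProd L t (Q (Ψ t x)))
      -- Since conj b • (Ψ - T) is analytic, Ψ may be replaced by its value T; then QT = T removes
      -- Q.
      have hBT : MemHInfty fun t => (conj (b t) • B₁ t) ∘L T := by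
        refine (hBQΨ.sub (hBQ.comp hT)).congr (.of_forall fun t => ?_)
        ext x
        simp [hQT, smul_sub]
      -- Density of the range of T in that of Q turns analyticity after T into analyticity after Q.
      have hR := hBP.add ((hB₁.1.smul hbc).memHInfty_comp_starProjection hBT)
      refine hco D' X ⟨hX, _, hR, ?_⟩ ⟨hX, B₂, hB₂, hXB₂⟩
      filter_upwards [hΔ] with t h1
      ext y
      simp only [← hQ, smul_apply, comp_apply, map_sub, map_smul, h1, hP,
        add_apply, map_add, hQQ, sub_self, map_zero]
      linear_combination (norm := module) -((hb t) • potapovProd L t (Q y))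

end Coprime

/-! ### Kernels of Hankel operators. -/

section HankelKernel

variable {D : Type*} [NormedAddCommGroup D] [InnerProductSpace ℂ D] [CompleteSpace D]
variable {E : Type*} [NormedAddCommGroup E] [InnerProductSpace ℂ E]

theorem reflect_eq_zero_iff {g : Lp E 2 m} : reflect g = 0 ↔ g = 0 := by
  have hmp := Measure.measurePreserving_neg (m : Measure UnitAddCircle)
  have hqmp := hmp.quasiMeasurePreserving
  rw [reflect, ← MemLp.toLp_zero (MemLp.zero : MemLp (0 : UnitAddCircle → E) 2 m),
    MemLp.toLp_eq_toLp_iff, MemLp.toLp_zero, Lp.eq_zero_iff_ae_eq_zero]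
  have hc : ∀ t : UnitAddCircle, conj (coord t) ≠ 0 := fun t h => by
    simpa [h] using conj_coord_mul t
  refine ⟨fun h => ?_, fun h => ?_⟩
  · filter_upwards [hqmp.ae h] with t ht
    simpa [hc] using ht
  · filter_upwards [hqmp.ae h] with t ht
    simp only [Pi.zero_apply] at ht ⊢
    rw [ht, smul_zero]

/-- J is injective, and H² is closed, hence equal to its double orthogonal complement. -/
theorem hankel_eq_zero_iff {Ψ : UnitAddCircle → E →L[ℂ] D} {f : Lp E 2 m}
    (h : MemLp (fun t => Ψ t (f t)) 2 m) :
    hankel Ψ f h = 0 ↔ MemHTwo (fun t => Ψ t (f t)) := by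
  have : CompleteSpace (hardyTwo D) := isClosed_hardyTwo.completeSpace_coe
  rw [hankel, reflect_eq_zero_iff, Submodule.starProjection_apply_eq_zero_iff,
    Submodule.orthogonal_orthogonal]
  exact ⟨fun hf => (memHTwo_of_mem hf).congr h.coeFn_toLp, fun hf => hf.toLp_mem⟩

end HankelKernel

/-! ### Rationality and the two implications. -/

section Rational

variable {D : Type v} [NormedAddCommGroup D] [InnerProductSpace ℂ D] [CompleteSpace D]
variable {E : Type u} [NormedAddCommGroup E] [InnerProductSpace ℂ E] [CompleteSpace E]

theorem isFiniteBlaschkeProduct_iff {θ : UnitAddCircle → ℂ} :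
    IsFiniteBlaschkeProduct θ ↔ ∃ (ν : ℂ) (l : List ℂ), ‖ν‖ = 1 ∧ (∀ α ∈ l, ‖α‖ < 1) ∧
      ∀ t, θ t = ν * blaschkeProd l t := by
  constructor
  · rintro ⟨ν, n, α, hν, hα, h⟩
    refine ⟨ν, List.ofFn α, hν, List.forall_mem_ofFn_iff.2 hα, fun t => ?_⟩
    rw [h, blaschkeProd, List.map_ofFn, List.prod_ofFn]
    rfl
  · rintro ⟨ν, l, hν, hl, h⟩
    refine ⟨ν, l.length, l.get, hν, fun i => hl _ (l.get_mem i), fun t => ?_⟩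
    rw [h, blaschkeProd, ← List.prod_ofFn]
    congr 2
    conv_lhs => rw [← List.ofFn_get l, List.map_ofFn]
    rfl

theorem adjoint_smul_adjoint (c : ℂ) (T : D →L[ℂ] E) :
    adjoint (c • adjoint T) = conj c • T := by
  rw [map_smulₛₗ, adjoint_adjoint]

/-- `Φ` is rational if and only if `Φ = θ A*` with a finite Blaschke product `θ` and `A` in
`H^∞`. -/
theorem isRational_iff {Φ : UnitAddCircle → D →L[ℂ] E} (hΦ : MemHInfty Φ) :
    IsRational Φ ↔ ∃ l : List ℂ, (∀ α ∈ l, ‖α‖ < 1) ∧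
      MemHInfty fun t => blaschkeProd l t • adjoint (Φ t) := by
  constructor
  · rintro ⟨θ, hθ, h⟩
    obtain ⟨ν, l, hν, hl, hθ⟩ := isFiniteBlaschkeProduct_iff.1 hθ
    have hν0 : ν ≠ 0 := by
      rintro rfl
      simp at hν
    refine ⟨l, hl, ?_⟩
    have hx : ∀ x, MemHTwo fun t => (blaschkeProd l t • adjoint (Φ t)) x := by
      intro x
      -- The constant ν⁻¹x absorbs the unimodular factor of θ.
      have hf : MemHTwo fun t => θ t • ν⁻¹ • x := by
        refine (((memHInfty_const (ContinuousLinearMap.id ℂ E)).blaschkeProd_smul hl).apply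
          x).congr (.of_forall fun t => ?_)
        simp only [hθ, smul_smul, smul_apply, id_apply]
        rw [mul_right_comm, mul_inv_cancel₀ hν0, one_mul]
      have hmem : hf.1.toLp _ ∈ {g : Lp E 2 m | ∃ f ∈ hardyTwo E, ∀ᵐ t ∂m, g t = θ t • f t} := by
        refine ⟨_, (memHTwo_const (ν⁻¹ • x)).toLp_mem, ?_⟩
        filter_upwards [hf.1.coeFn_toLp, (memHTwo_const (ν⁻¹ • x)).1.coeFn_toLp] with t h1 h2
        rw [h1, h2]
      obtain ⟨-, h1, h2⟩ := h hmem
      refine ((hankel_eq_zero_iff h1).1 h2).congr ?_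
      filter_upwards [hf.1.coeFn_toLp] with t ht
      rw [ht, hθ, smul_smul, mul_right_comm, mul_inv_cancel₀ hν0, one_mul, map_smul, smul_apply]
    -- SOT-measurability of θΦ* is part of what membership in the Hankel kernel provides.
    refine MemLInfty.memHInfty ⟨fun x => (hx x).1.1, hΦ.1.2.imp fun C hC => ?_⟩ hx
    filter_upwards [hC] with t ht
    rwa [norm_smul, norm_blaschkeProd hl, one_mul, LinearIsometryEquiv.norm_map]
  · rintro ⟨l, hl, hA⟩
    refine ⟨blaschkeProd l, isFiniteBlaschkeProduct_iff.2 ⟨1, l, norm_one, hl, by simp⟩, ?_⟩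
    rintro g ⟨f, hf, hgf⟩
    have hg : MemHTwo g := by
      refine (((memHInfty_const (ContinuousLinearMap.id ℂ E)).blaschkeProd_smul hl).memHTwo
        (memHTwo_of_mem hf)).congr ?_
      filter_upwards [hgf] with t ht
      rw [ht]
      rfl
    have hH : MemHTwo fun t => adjoint (Φ t) (g t) := by
      refine (hA.memHTwo (memHTwo_of_mem hf)).congr ?_
      filter_upwards [hgf] with t ht
      rw [ht, map_smul, smul_apply]
    exact ⟨hg.2, hH.1, (hankel_eq_zero_iff hH.1).2 hH⟩

/-- Common divisors are removed from θ̃I and Ã₀, and applying `tilde` again returns right coprime Δ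
and A. -/
theorem exists_coprime_of_isRational {Φ : UnitAddCircle → D →L[ℂ] E} (hΦ : MemHInfty Φ)
    (h : IsRational Φ) :
    ∃ (Δ : UnitAddCircle → E →L[ℂ] E) (A : UnitAddCircle → E →L[ℂ] D),
      IsFiniteBlaschkePotapovProduct Δ ∧ MemHInfty A ∧ RightCoprime Δ A ∧
        ∀ t, Φ t = Δ t ∘L adjoint (A t) := by
  obtain ⟨l, hl, hA₀⟩ := (isRational_iff hΦ).1 h
  set A₀ : UnitAddCircle → E →L[ℂ] D := fun t => blaschkeProd l t • adjoint (Φ t) with hA₀def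
  have hl' : ∀ α ∈ l.map conj, ‖α‖ < 1 := by
    intro α hα
    obtain ⟨β, hβ, rfl⟩ := List.mem_map.1 hα
    simpa using hl β hβ
  have hΦA : ∀ t, Φ t = blaschkeProd l t • adjoint (A₀ t) := fun t => by
    rw [hA₀def, adjoint_smul_adjoint, smul_smul, mul_comm, conj_blaschkeProd_mul_self hl, one_smul]
  -- The adjoint of A₀ is conj θ • Φ, and Φ is SOT-measurable by hypothesis.
  have hA₀m : ∀ x, AEStronglyMeasurable (fun t => adjoint (A₀ t) x) m := by
    intro x
    have hc : AEStronglyMeasurable (fun t => conj (blaschkeProd l t)) m := by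
      refine (Complex.continuous_conj.comp ?_).aestronglyMeasurable
      exact continuous_list_prod l fun α hα => continuous_circleBlaschke (hl α hα)
    refine (hc.smul (hΦ.1.1 x)).congr (.of_forall fun t => ?_)
    simp only [hA₀def, adjoint_smul_adjoint]
    rfl
  obtain ⟨Ω, L, Ψ, hΩ, hL, hΨ, hΩL, hLΩ, hfac, hco⟩ :=
    exists_coprime_factorization hl' (hA₀.tilde hA₀m)
  set ϑ := blaschkeProd (l.map conj) with hϑ
  have hϑ1 : ∀ t, conj (ϑ t) * ϑ t = 1 := conj_blaschkeProd_mul_self hl'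
  have hstar : ∀ t, adjoint (potapovProd L t) = conj (ϑ t) • Ω t := by
    intro t
    have h1 : adjoint (potapovProd L t) * (potapovProd L t * Ω t) = Ω t := by
      rw [← mul_assoc, adjoint_potapovProd_mul_self hL, one_mul]
    rw [hLΩ, mul_smul_comm, mul_one] at h1
    rw [← h1, smul_smul, hϑ1, one_smul]
  have hΩΩ : ∀ t, adjoint (Ω t) * Ω t = 1 := by
    intro t
    have h1 : potapovProd L t = ϑ t • adjoint (Ω t) := by
      rw [← adjoint_adjoint (potapovProd L t), hstar, map_smulₛₗ, Complex.conj_conj]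
    have h2 := hLΩ t
    rw [h1, smul_mul_assoc] at h2
    have h3 := congrArg (conj (ϑ t) • ·) h2
    simpa only [smul_smul, hϑ1, one_smul] using h3
  -- Since Ω*Ω = I, the adjoint of Ψ is a product of SOT-measurable functions; this supplies the
  -- measurability needed for `tilde Ψ`.
  have hΨm : ∀ t x, adjoint (Ψ t) x = A₀ (-t) (Ω t x) := by
    intro t x
    have h1 : A₀ (-t) = adjoint (Ψ t) ∘L adjoint (Ω t) := by
      rw [← adjoint_comp, ← hfac, tilde, adjoint_adjoint]
    rw [h1]
    exact congrArg (adjoint (Ψ t)) (congrArg (· x) (hΩΩ t)).symm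
  refine ⟨tilde (potapovProd L), tilde Ψ, ?_, hΨ.tilde fun x => ?_, ?_, fun t => ?_⟩
  · rw [tilde_potapovProd hL]
    exact hL.tilde.isFiniteBlaschkePotapovProduct
  · refine AEStronglyMeasurable.congr ?_ (.of_forall fun t => (hΨm t x).symm)
    exact aestronglyMeasurable_clm_apply (A := fun t => A₀ (-t))
      (fun y => (hA₀.1.1 y).comp_measurePreserving (Measure.measurePreserving_neg m))
      (hΩ.1.1 x)
  · rw [RightCoprime, tilde_tilde, tilde_tilde]
    exact hco
  · have h1 : adjoint (A₀ t) = Ω (-t) ∘L Ψ (-t) := by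
      rw [← hfac, tilde, neg_neg]
    rw [hΦA, h1, tilde, tilde, adjoint_adjoint, hstar, hϑ, blaschkeProd_neg, Complex.conj_conj,
      smul_comp]

/-- With Δ = V·`potapovProd L` and θ the scalar product over the same zeros, θΦ* = A(θ(`potapovProd
L`)*)V* is a product of H^∞ functions. -/
theorem isRational_of_factorization {Φ : UnitAddCircle → D →L[ℂ] E} (hΦ : MemHInfty Φ)
    {Δ : UnitAddCircle → E →L[ℂ] E} {A : UnitAddCircle → E →L[ℂ] D}
    (hΔ : IsFiniteBlaschkePotapovProduct Δ) (hA : MemHInfty A)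
    (h : ∀ᵐ t ∂m, Φ t = Δ t ∘L adjoint (A t)) : IsRational Φ := by
  obtain ⟨V, n, α, P, -, hα, hP, hΔ⟩ := hΔ
  set L : List (ℂ × (E →L[ℂ] E)) := List.ofFn fun i => (α i, P i) with hLdef
  have hL : IsPotapovList L := List.forall_mem_ofFn_iff.2 fun i => ⟨hα i, hP i⟩
  have hLp : ∀ t, potapovProd L t =
      (List.ofFn fun i => blaschkeFactor (α i) (coord t) • P i + (1 - P i)).prod := fun t => by
    rw [potapovProd, hLdef, List.map_ofFn]
    rfl
  refine (isRational_iff hΦ).2 ⟨L.map Prod.fst, fun β hβ => ?_, ?_⟩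
  · obtain ⟨p, hp, rfl⟩ := List.mem_map.1 hβ
    exact (hL p hp).1
  · refine (hA.comp ((memHInfty_blaschkeProd_smul_adjoint hL).comp
      (memHInfty_const (adjoint V)))).congr ?_
    filter_upwards [h, hΔ] with t h1 h2
    have h3 : V * potapovProd L t = V ∘L potapovProd L t := rfl
    rw [h1, h2, ← hLp, h3, adjoint_comp, adjoint_comp, adjoint_adjoint, smul_comp, comp_smul]

end Rational

end OperatorHardy

theorem corollary3p6 {D : Type*} [NormedAddCommGroup D] [InnerProductSpace ℂ D] [CompleteSpace D]
    {E : Type*} [NormedAddCommGroup E] [InnerProductSpace ℂ E] [CompleteSpace E]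
    (Φ : UnitAddCircle → D →L[ℂ] E) (hΦ : OperatorHardy.MemHInfty Φ) :
    OperatorHardy.IsRational Φ ↔
      ∃ (Δ : UnitAddCircle → E →L[ℂ] E) (A : UnitAddCircle → E →L[ℂ] D),
        OperatorHardy.IsFiniteBlaschkePotapovProduct Δ ∧ OperatorHardy.MemHInfty A ∧
        OperatorHardy.RightCoprime Δ A ∧
        ∀ᵐ t ∂OperatorHardy.m, Φ t = Δ t ∘L ContinuousLinearMap.adjoint (A t) := by
  constructor
  · intro h
    obtain ⟨Δ, A, h1, h2, h3, h4⟩ := OperatorHardy.exists_coprime_of_isRational hΦ h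
    exact ⟨Δ, A, h1, h2, h3, .of_forall h4⟩
  · rintro ⟨Δ, A, h1, h2, -, h4⟩
    exact OperatorHardy.isRational_of_factorization hΦ h1 h2 h4
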